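/- Let $R=\mathbb C[x_1,\dots,x_N]$ with $N\ge 1$, $\mathfrak m=(x_1,\dots,x_N)$, and $R_0=R_{\mathfrak m}$. For $\alpha\in\mathbb Z_{\ge0}^N$ let $\partial^\alpha$ be the functional $g\mapsto \frac1{\alpha!}\frac{\partial^{|\alpha|}g}{\partial x^\alpha}(0)$ on $R$, let $D_0$ be the complex span of all $\partial^\alpha$, and for an ideal $I\subseteq R$ put $D_0[I]=\{q\in D_0: q(g)=0\text{ for all }g\in I\}$. For an integer $d$ let $$E_0^d[I,\{x_1\}]=\{q\in D_0[I] : \text{every } \partial^\alpha \text{ occurring in } q \text{ has } \alpha_1\le d\},$$ so that $E_0^{d}[I,\{x_1\}]=0$ for $d<0$. For $q\in D_0$ let $x_1\cdot q$ be the functional $f\mapsto q(x_1f)$. Let $H_I(k)=\dim_{\mathbb C}R_0/(IR_0+\mathfrak m^{k+1}R_0)-\dim_{\mathbb C}R_0/(IR_0+\mathfrak m^{k}R_0)$ be the local Hilbert function of $I$ at the origin, $\mathrm{HP}_I$ its Hilbert polynomial (the polynomial that agrees with $H_I(k)$ for all large $k$), and $\rho_0(I)=\min\{m\ge0: H_I(k)=\mathrm{HP}_I(k)\text{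 for all }k\ge m\}$. Let $\mu_0(I)$ be the multiplicity of $I$ at the origin, i.e. $a\cdot e!$ where $a k^e$ is the leading term of $\mathrm{HP}_I(k)$; when $\dim R_0/IR_0=1$ it is the constant value of $\mathrm{HP}_I$. Theorem. Let $I\subseteq R$ be an ideal that is one-dimensional at the origin, i.e. $\dim R_0/IR_0=1$, and in general position with respect to $x_1$, i.e. no irreducible component of $\mathbb V(I)$ through the origin is contained in the hyperplane $x_1=0$. Set $k=\max(\rho_0(I),\mu_0(I)-1)$. Then the origin is an embedded component of $I$ (that is, $\mathfrak m$ is an associated prime of $R/I$ that is not minimal over $I$) if and only if $$x_1\cdot E_0^k[I,\{x_1\}]\subsetneq E_0^{k-1}[I,\{x_1\}].$$ -/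

import Mathlib

open MvPolynomial

noncomputable section

namespace DualSpace

/-- The polynomial ring `R = ℂ[x₁, …, x_N]`; the variable `x_{i+1}` is `X i` for `i : Fin N`. -/
abbrev PolyRing (N : ℕ) : Type := MvPolynomial (Fin N) ℂ

/-- The maximal ideal `𝔪 = (x₁, …, x_N)` of the origin. -/
abbrev originIdeal (N : ℕ) : Ideal (PolyRing N) := idealOfVars (Fin N) ℂ

theorem originIdeal_eq_ker (N : ℕ) :
    originIdeal N = RingHom.ker (constantCoeff : PolyRing N →+* ℂ) := by
  ext p
  have h := mem_pow_idealOfVars_iff' (σ := Fin N) (R := ℂ) 1 p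
  rw [pow_one] at h
  rw [h, RingHom.mem_ker, constantCoeff_eq]
  constructor
  · intro h
    exact h 0 (by simp)
  · intro h x hx
    have hx0 : x = 0 := by
      rw [← Finsupp.degree_eq_zero_iff]
      omega
    rw [hx0, h]

instance originIdeal_isPrime (N : ℕ) : (originIdeal N).IsPrime := by
  rw [originIdeal_eq_ker]
  exact RingHom.ker_isPrime _

/-- The local ring `R₀ = R_𝔪` of rational functions whose denominator does not vanish at `0`. -/
abbrev LocalRing (N : ℕ) : Type := Localization.AtPrime (originIdeal N)

/-- The extension `I R₀` of an ideal `I ⊆ R`. -/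
abbrev extend {N : ℕ} (I : Ideal (PolyRing N)) : Ideal (LocalRing N) :=
  I.map (algebraMap (PolyRing N) (LocalRing N))

/-! ### Dual spaces -/

/-- The partial derivative `∂^{|α|} / ∂x^α` as a linear operator on `R`. -/
def iteratedPartial {N : ℕ} (α : Fin N → ℕ) : Module.End ℂ (PolyRing N) :=
  (List.ofFn fun i : Fin N => ((pderiv i : Derivation ℂ (PolyRing N) (PolyRing N)) :
    Module.End ℂ (PolyRing N)) ^ α i).prod

/-- The functional `∂^α[y] : g ↦ (1 / α!) (∂^{|α|} g / ∂x^α)(y)`. -/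
def diffFunctional {N : ℕ} (y : Fin N → ℂ) (α : Fin N → ℕ) : Module.Dual ℂ (PolyRing N) :=
  ((∏ i, (α i).factorial : ℕ) : ℂ)⁻¹ • ((aeval y).toLinearMap ∘ₗ iteratedPartial α)

/-- The space `D_y` of differential functionals at `y`: the span of all `∂^α[y]`. -/
def diffSpace {N : ℕ} (y : Fin N → ℂ) : Submodule ℂ (Module.Dual ℂ (PolyRing N)) :=
  Submodule.span ℂ (Set.range (diffFunctional y))

/-- The functionals that vanish on the ideal `I`. -/
def annihilator {N : ℕ} (I : Ideal (PolyRing N)) : Submodule ℂ (Module.Dual ℂ (PolyRing N)) :=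
  (I.restrictScalars ℂ).dualAnnihilator

/-- The Macaulay dual space `D_y[I] = {q ∈ D_y | q(g) = 0 for all g ∈ I}`. -/
def dualSpace {N : ℕ} (y : Fin N → ℂ) (I : Ideal (PolyRing N)) :
    Submodule ℂ (Module.Dual ℂ (PolyRing N)) :=
  diffSpace y ⊓ annihilator I

/-- The differential functionals `q` at the origin with `ord_A q ≤ d`, where
`ord_A ∂^α = ∑_{i ∈ A} α_i` and `ord_A q` is the maximal order of the terms of `q`: the
combinations of those `∂^α` with `ord_A ∂^α ≤ d`. For `d < 0` only `q = 0` remains. -/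
def ordLE {N : ℕ} (A : Finset (Fin N)) (d : ℤ) : Submodule ℂ (Module.Dual ℂ (PolyRing N)) :=
  Submodule.span ℂ (diffFunctional 0 '' {α : Fin N → ℕ | ((∑ i ∈ A, α i : ℕ) : ℤ) ≤ d})

/-- The eliminating truncated dual space `E₀^d[I, A] = {q ∈ D₀[I] | ord_A q ≤ d}`. -/
def eliminatingDual {N : ℕ} (I : Ideal (PolyRing N)) (A : Finset (Fin N)) (d : ℤ) :
    Submodule ℂ (Module.Dual ℂ (PolyRing N)) :=
  dualSpace 0 I ⊓ ordLE A d

/-- The set `g · L` of all functionals `g · q : f ↦ q (g f)` with `q ∈ L`. -/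
def act {N : ℕ} (g : PolyRing N) (L : Submodule ℂ (Module.Dual ℂ (PolyRing N))) :
    Submodule ℂ (Module.Dual ℂ (PolyRing N)) :=
  L.map (LinearMap.mulLeft ℂ g).dualMap

/-! ### Hilbert function, regularity index and multiplicity -/

/-- The Hilbert function
`H_J(k) = dim_ℂ R₀ / (J + 𝔪^{k+1}) - dim_ℂ R₀ / (J + 𝔪^k)` of an ideal `J ⊆ R₀`. -/
def hilbertFunction {N : ℕ} (J : Ideal (LocalRing N)) (k : ℕ) : ℤ :=
  (Module.finrank ℂ (LocalRing N ⧸ (J ⊔ IsLocalRing.maximalIdeal (LocalRing N) ^ (k + 1))) : ℤ) -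
    Module.finrank ℂ (LocalRing N ⧸ (J ⊔ IsLocalRing.maximalIdeal (LocalRing N) ^ k))

open Classical in
/-- The Hilbert polynomial: the (unique) polynomial that agrees with `H_J(k)` for all large `k`. -/
def hilbertPolynomial {N : ℕ} (J : Ideal (LocalRing N)) : Polynomial ℚ :=
  if h : ∃ P : Polynomial ℚ, ∀ᶠ k : ℕ in Filter.atTop,
      (hilbertFunction J k : ℚ) = P.eval (k : ℚ)
  then h.choose else 0

/-- The regularity index `ρ₀(J) = min {m | H_J(k) = HP_J(k) for all k ≥ m}`. -/
def regularityIndex {N : ℕ} (J : Ideal (LocalRing N)) : ℕ :=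
  sInf {m : ℕ | ∀ k : ℕ, m ≤ k →
    (hilbertFunction J k : ℚ) = (hilbertPolynomial J).eval (k : ℚ)}

/-- The multiplicity `μ₀(J)` of an ideal `J ⊆ R₀` of positive dimension: `a · e!`, where
`HP_J(k) = a k^e + (lower order terms)` with `a ≠ 0`. It is a natural number, so that the rounding
changes nothing. For `J` of dimension one, `HP_J` is the constant `μ₀(J)`. -/
def multiplicity {N : ℕ} (J : Ideal (LocalRing N)) : ℕ :=
  ⌊(hilbertPolynomial J).leadingCoeff * ((hilbertPolynomial J).natDegree.factorial : ℚ)⌋₊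

/-! ### Curves -/

/-- `dim₀ I = 1`: the variety of `I` is a curve near the origin. -/
def IsCurveAtOrigin {N : ℕ} (I : Ideal (PolyRing N)) : Prop :=
  ringKrullDim (LocalRing N ⧸ extend I) = 1

/-- `I` is in general position with respect to the variable `x_i` (at the origin): no irreducible
component of the variety of `I` that passes through the origin lies in the hyperplane `x_i = 0`. -/
def InGeneralPosition {N : ℕ} (I : Ideal (PolyRing N)) (i : Fin N) : Prop :=
  ∀ P ∈ I.minimalPrimes, P ≤ originIdeal N → (X i : PolyRing N) ∉ P

/-- The origin is an embedded component of `I`: the ideal of the origin is an associated prime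
of `R / I`, but not a minimal one. -/
def OriginIsEmbedded {N : ℕ} (I : Ideal (PolyRing N)) : Prop :=
  originIdeal N ∈ associatedPrimes (PolyRing N) (PolyRing N ⧸ I) ∧
    originIdeal N ∉ I.minimalPrimes

end DualSpace

end

noncomputable section

namespace DualSpace

/-! ### Differential functionals -/

/-! Write x for the chosen variable and J for `localClosure I`, the contraction of IR₀ to R.
Dimension one and general position force IR₀ + (x) to contain a power of the maximal ideal, so the
origin is embedded exactly when x is a zero divisor modulo J (`originIsEmbedded_iff`).

On the dual side, E^{e-1} consists of the functionals killing I + (x^e) + 𝔪^m for some m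
(`mem_eliminatingDual_singleton_iff`), which gives x·E^k ⊆ E^{k-1} at once. If x is regular modulo
J, each q in E^{k-1} can be divided by x (`eliminatingDual_le_act`). If xz ∈ J with z ∉ J, every
element of x·E^k kills z; when moreover z ∉ I + 𝔪^k, some functional killing I + 𝔪^k, hence lying in
E^{k-1}, does not (`not_eliminatingDual_le_act`).

It remains to see that z ∉ J + 𝔪^k, and only here does the choice of k matter. The claim is (J : x)
∩ (J + 𝔪^k) ⊆ J, which follows by Krull's theorem once J and J : x have the same Hilbert function
from degree k on (`colonElement_inf_sup_pow_le`). From k ≥ ρ₀ the Hilbert function of J is the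
constant μ there. If that of J : x fell below μ in a degree n ≥ k, then k ≥ μ - 1 would make its
value at most n, and Macaulay's growth bound (`card_stdMonomials_succ_le`) would keep it below μ
forever. But multiplication by x shows that the codimensions of J + 𝔪^{n+1} and (J : x) + 𝔪^n differ
by a bounded amount at most (`codimPow_succ_le`), a contradiction. Hilbert functions are computed
throughout by counting standard monomials. -/

theorem pderiv_pow_monomial {N : ℕ} (i : Fin N) (a : ℕ) (β : Fin N →₀ ℕ) (c : ℂ) :
    (((pderiv i : Derivation ℂ (PolyRing N) (PolyRing N)) : Module.End ℂ (PolyRing N)) ^ a)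
      (monomial β c) = monomial (β - Finsupp.single i a) (c * ((β i).descFactorial a : ℂ)) := by
  induction a with
  | zero => simp
  | succ a ih =>
    rw [pow_succ', Module.End.mul_apply, ih]
    change pderiv i _ = _
    rw [pderiv_monomial]
    have h : β - Finsupp.single i a - Finsupp.single i 1 = β - Finsupp.single i (a + 1) := by
      rw [tsub_tsub, ← Finsupp.single_add]
    rw [h]
    congr 1
    · simp [Nat.descFactorial_succ]
      ring

/-- Differentiating in one variable leaves the other exponents alone, so without repetitions the
descending factorials are all taken at the original β. -/
theorem list_pderiv_prod_monomial {N : ℕ} (α : Fin N → ℕ) (l : List (Fin N)) (hl : l.Nodup)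
    (β : Fin N →₀ ℕ) (c : ℂ) :
    (l.map fun i => ((pderiv i : Derivation ℂ (PolyRing N) (PolyRing N)) :
      Module.End ℂ (PolyRing N)) ^ α i).prod (monomial β c) =
      monomial (β - ∑ i ∈ l.toFinset, Finsupp.single i (α i))
        (c * ((∏ i ∈ l.toFinset, (β i).descFactorial (α i) : ℕ) : ℂ)) := by
  induction l with
  | nil => simp
  | cons i l ih =>
    rw [List.nodup_cons] at hl
    have hi : i ∉ l.toFinset := by simpa using hl.1
    have h0 : (∑ j ∈ l.toFinset, Finsupp.single j (α j)) i = 0 := by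
      rw [Finsupp.finsetSum_apply]
      refine Finset.sum_eq_zero fun j hj => ?_
      rw [Finsupp.single_apply, if_neg]
      rintro rfl
      exact hi hj
    rw [List.map_cons, List.prod_cons, Module.End.mul_apply, ih hl.2, pderiv_pow_monomial,
      List.toFinset_cons, Finset.sum_insert hi, Finset.prod_insert hi]
    congr 1
    · rw [tsub_tsub, add_comm]
    · rw [Finsupp.tsub_apply, h0, tsub_zero]
      push_cast
      ring

theorem iteratedPartial_monomial {N : ℕ} (α : Fin N → ℕ) (β : Fin N →₀ ℕ) (c : ℂ) :
    iteratedPartial α (monomial β c) =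
      monomial (β - Finsupp.equivFunOnFinite.symm α)
        (c * ((∏ i, (β i).descFactorial (α i) : ℕ) : ℂ)) := by
  have h := list_pderiv_prod_monomial α (List.finRange N) (List.nodup_finRange N) β c
  rw [← List.ofFn_eq_map] at h
  rw [iteratedPartial, h, List.toFinset_finRange]
  congr 2
  ext j
  simp [Finsupp.single_apply]

theorem diffFunctional_zero_apply {N : ℕ} (α : Fin N → ℕ) (p : PolyRing N) :
    diffFunctional 0 α p = coeff (Finsupp.equivFunOnFinite.symm α) p := by
  suffices h : diffFunctional 0 α = lcoeff ℂ (Finsupp.equivFunOnFinite.symm α) by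
    rw [h]; rfl
  refine MvPolynomial.linearMap_ext fun β => LinearMap.ext_ring ?_
  simp only [diffFunctional, LinearMap.comp_apply, LinearMap.smul_apply, AlgHom.toLinearMap_apply,
    iteratedPartial_monomial, one_mul, lcoeff_apply, coeff_monomial, smul_eq_mul]
  rw [aeval_monomial]
  split_ifs with h
  · subst h
    have h1 : ((∏ i, (α i).factorial : ℕ) : ℂ) ≠ 0 := by
      exact_mod_cast Finset.prod_ne_zero_iff.2 fun i _ => Nat.factorial_ne_zero _
    have h2 : (∏ i, (α i).descFactorial (α i)) = ∏ i, (α i).factorial :=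
      Finset.prod_congr rfl fun i _ => Nat.descFactorial_self _
    simp [h2, h1, -Nat.cast_prod]
  -- For β ≠ α, either a positive power of some variable survives and vanishes at 0, or some
  -- exponent is too small and its descending factorial is 0.
  · by_cases hle : ∀ i, α i ≤ β i
    · have : ∃ i, β i - α i ≠ 0 := by
        by_contra! hc
        apply h
        ext i
        have := hc i
        have := hle i
        simp only [Finsupp.equivFunOnFinite_symm_apply_apply]
        omega
      obtain ⟨i, hi⟩ := this
      have : (β - Finsupp.equivFunOnFinite.symm α).prod
          (fun i k => ((0 : Fin N → ℂ) i) ^ k) = 0 := by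
        refine Finset.prod_eq_zero (i := i) ?_ ?_
        · simpa using hi
        · simpa using Nat.pos_of_ne_zero hi |>.ne'
      rw [this]
      simp
    · push Not at hle
      obtain ⟨i, hi⟩ := hle
      have h0 : ∏ i, (β i).descFactorial (α i) = 0 :=
        Finset.prod_eq_zero (Finset.mem_univ i) (Nat.descFactorial_eq_zero_iff_lt.2 hi)
      rw [h0]
      simp

/-- The elements of `ordLE A d` are the functionals that kill some power of the maximal ideal of
the origin and all monomials of `A`-order greater than `d`. -/
theorem mem_ordLE_iff {N : ℕ} (A : Finset (Fin N)) (d : ℤ) (q : Module.Dual ℂ (PolyRing N)) :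
    q ∈ ordLE A d ↔ (∃ m : ℕ, ∀ f ∈ originIdeal N ^ m, q f = 0) ∧
      ∀ α : Fin N →₀ ℕ, d < ((∑ i ∈ A, α i : ℕ) : ℤ) → q (monomial α 1) = 0 := by
  constructor
  · intro hq
    induction hq using Submodule.span_induction with
    | mem q hq =>
      obtain ⟨α, hα, rfl⟩ := hq
      refine ⟨⟨(Finsupp.equivFunOnFinite.symm α).degree + 1, fun f hf => ?_⟩, fun β hβ => ?_⟩
      · rw [diffFunctional_zero_apply]
        exact (mem_pow_idealOfVars_iff' _ _).1 hf _ (Nat.lt_succ_self _)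
      · rw [diffFunctional_zero_apply, coeff_monomial, if_neg]
        rintro rfl
        exact absurd hα (not_le.2 hβ)
    | zero => exact ⟨⟨0, fun _ _ => rfl⟩, fun _ _ => rfl⟩
    | add p q _ _ hp hq =>
      obtain ⟨⟨a, ha⟩, hp⟩ := hp
      obtain ⟨⟨b, hb⟩, hq⟩ := hq
      refine ⟨⟨max a b, fun f hf => ?_⟩, fun β hβ => ?_⟩
      · rw [LinearMap.add_apply, ha f (Ideal.pow_le_pow_right (le_max_left a b) hf),
          hb f (Ideal.pow_le_pow_right (le_max_right a b) hf), add_zero]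
      · rw [LinearMap.add_apply, hp β hβ, hq β hβ, add_zero]
    | smul c q _ hq =>
      obtain ⟨⟨a, ha⟩, hq⟩ := hq
      refine ⟨⟨a, fun f hf => ?_⟩, fun β hβ => ?_⟩
      · rw [LinearMap.smul_apply, ha f hf, smul_zero]
      · rw [LinearMap.smul_apply, hq β hβ, smul_zero]
  · rintro ⟨⟨m, hm⟩, hA⟩
    have hfin : {α : Fin N →₀ ℕ | α.degree ≤ m}.Finite := Finsupp.finite_of_degree_le m
    -- The ∂^α are dual to the monomials; vanishing on a power of 𝔪 makes the expansion finite.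
    have hsum : q = ∑ α ∈ hfin.toFinset, q (monomial α 1) • diffFunctional 0 (⇑α) := by
      refine MvPolynomial.linearMap_ext fun β => LinearMap.ext_ring ?_
      simp only [LinearMap.comp_apply, LinearMap.sum_apply, LinearMap.smul_apply,
        diffFunctional_zero_apply, coeff_monomial, smul_eq_mul]
      by_cases hβ : β.degree ≤ m
      · rw [Finset.sum_eq_single β]
        · simp
        · intro α _ hne
          rw [if_neg, mul_zero]
          intro h
          apply hne
          rw [h]
          ext
          simp
        · intro h
          exact absurd (hfin.mem_toFinset.2 hβ) h
      · rw [hm _ ((monomial_mem_pow_idealOfVars_iff _ _ one_ne_zero).2 (by omega))]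
        refine (Finset.sum_eq_zero fun α hα => ?_).symm
        rw [if_neg, mul_zero]
        intro h
        apply hβ
        have h' : β = α := by rw [h]; ext; simp
        rw [h']
        exact hfin.mem_toFinset.1 hα
    rw [hsum]
    refine Submodule.sum_mem _ fun α _ => ?_
    by_cases h : d < ((∑ i ∈ A, α i : ℕ) : ℤ)
    · rw [hA α h, zero_smul]
      exact zero_mem _
    · exact Submodule.smul_mem _ _ (Submodule.subset_span ⟨_, not_lt.1 h, rfl⟩)

theorem ordLE_le_diffSpace {N : ℕ} (A : Finset (Fin N)) (d : ℤ) : ordLE A d ≤ diffSpace 0 :=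
  Submodule.span_mono (Set.image_subset_range _ _)

/-- The monomials of x-order above e - 1 are the multiples of x^e, which turns an order bound into
annihilation of an ideal. The shift by one includes e = 0, where both sides say q = 0. -/
theorem mem_eliminatingDual_singleton_iff {N : ℕ} (I : Ideal (PolyRing N)) (i : Fin N) (e : ℕ)
    (q : Module.Dual ℂ (PolyRing N)) :
    q ∈ eliminatingDual I {i} ((e : ℤ) - 1) ↔
      ∃ m : ℕ, ∀ f ∈ I ⊔ Ideal.span {(X i : PolyRing N) ^ e} ⊔ originIdeal N ^ m, q f = 0 := by
  have key : q ∈ eliminatingDual I {i} ((e : ℤ) - 1) ↔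
      (∀ f ∈ I, q f = 0) ∧ q ∈ ordLE {i} ((e : ℤ) - 1) := by
    rw [eliminatingDual, dualSpace, annihilator]
    constructor
    · rintro ⟨⟨_, h1⟩, h2⟩
      exact ⟨fun f hf => (Submodule.mem_dualAnnihilator q).1 h1 f hf, h2⟩
    · rintro ⟨h1, h2⟩
      exact ⟨⟨ordLE_le_diffSpace _ _ h2, (Submodule.mem_dualAnnihilator q).2 h1⟩, h2⟩
  rw [key, mem_ordLE_iff]
  simp only [Finset.sum_singleton]
  constructor
  · rintro ⟨hI, ⟨m, hm⟩, hx⟩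
    refine ⟨m, fun f hf => ?_⟩
    obtain ⟨g, hg, w, hw, rfl⟩ := Submodule.mem_sup.1 hf
    obtain ⟨u, hu, v, hv, rfl⟩ := Submodule.mem_sup.1 hg
    obtain ⟨g, rfl⟩ := Ideal.mem_span_singleton'.1 hv
    rw [map_add, map_add, hI u hu, hm w hw, zero_add, add_zero]
    have h : q ∘ₗ LinearMap.mulRight ℂ ((X i : PolyRing N) ^ e) = 0 := by
      refine MvPolynomial.linearMap_ext fun β => LinearMap.ext_ring ?_
      simp only [LinearMap.comp_apply, LinearMap.mulRight_apply, LinearMap.zero_apply]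
      rw [X_pow_eq_monomial, monomial_mul, one_mul]
      exact hx _ (by simp)
    exact LinearMap.congr_fun h g
  · rintro ⟨m, hm⟩
    refine ⟨fun f hf => hm f ?_, ⟨m, fun f hf => hm f ?_⟩, fun β hβ => hm _ ?_⟩
    · exact Ideal.mem_sup_left (Ideal.mem_sup_left hf)
    · exact Ideal.mem_sup_right hf
    · refine Ideal.mem_sup_left (Ideal.mem_sup_right (Ideal.mem_span_singleton'.2
        ⟨monomial (β - Finsupp.single i e) 1, ?_⟩))
      rw [X_pow_eq_monomial, monomial_mul, one_mul, tsub_add_cancel_of_le]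
      exact Finsupp.single_le_iff.2 (by omega)

/-! ### Contraction from the local ring at the origin -/

instance originIdeal_isMaximal (N : ℕ) : (originIdeal N).IsMaximal := by
  rw [originIdeal_eq_ker]
  exact RingHom.ker_isMaximal_of_surjective _ (fun c => ⟨C c, constantCoeff_C _ c⟩)

instance (N : ℕ) : IsNoetherianRing (LocalRing N) :=
  IsLocalization.isNoetherianRing (originIdeal N).primeCompl _ inferInstance

theorem map_originIdeal (N : ℕ) :
    extend (originIdeal N) = IsLocalRing.maximalIdeal (LocalRing N) :=
  IsLocalization.AtPrime.map_eq_maximalIdeal (originIdeal N) (LocalRing N)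

theorem map_originIdeal_pow (N m : ℕ) :
    extend (originIdeal N ^ m) = IsLocalRing.maximalIdeal (LocalRing N) ^ m := by
  rw [extend, Ideal.map_pow, ← map_originIdeal]

/-- The contraction to the polynomial ring of the extension of `K` to the local ring. -/
def localClosure {N : ℕ} (K : Ideal (PolyRing N)) : Ideal (PolyRing N) :=
  (extend K).comap (algebraMap (PolyRing N) (LocalRing N))

theorem mem_localClosure_iff {N : ℕ} {K : Ideal (PolyRing N)} {f : PolyRing N} :
    f ∈ localClosure K ↔ ∃ s ∉ originIdeal N, s * f ∈ K :=
  IsLocalization.algebraMap_mem_map_algebraMap_iff (originIdeal N).primeCompl _ K f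

theorem le_localClosure {N : ℕ} (K : Ideal (PolyRing N)) : K ≤ localClosure K :=
  Ideal.le_comap_map

theorem extend_localClosure {N : ℕ} (K : Ideal (PolyRing N)) :
    extend (localClosure K) = extend K :=
  Ideal.map_comap_map _ K

theorem exists_mul_sub_one_mem {N : ℕ} {s : PolyRing N} (hs : s ∉ originIdeal N) (m : ℕ) :
    ∃ t, t * s - 1 ∈ originIdeal N ^ m := by
  obtain ⟨t, ht⟩ := (Ideal.Quotient.isUnit_mk_pow_of_notMem (originIdeal N) hs
    (n := m)).exists_left_inv
  obtain ⟨t, rfl⟩ := Ideal.Quotient.mk_surjective t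
  exact ⟨t, by rwa [← Ideal.Quotient.eq_zero_iff_mem, map_sub, map_mul, map_one, sub_eq_zero]⟩

/-- A denominator outside 𝔪 is invertible modulo 𝔪^m. Hence localizing is invisible to functionals
that kill a power of 𝔪. -/
theorem localClosure_le_sup_pow {N : ℕ} (K : Ideal (PolyRing N)) (m : ℕ) :
    localClosure K ≤ K ⊔ originIdeal N ^ m := by
  intro f hf
  obtain ⟨s, hs, hsf⟩ := mem_localClosure_iff.1 hf
  obtain ⟨t, ht⟩ := exists_mul_sub_one_mem hs m
  have h : f = t * (s * f) - f * (t * s - 1) := by ring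
  rw [h]
  exact sub_mem (Ideal.mem_sup_left (Ideal.mul_mem_left _ _ hsf))
    (Ideal.mem_sup_right (Ideal.mul_mem_left _ _ ht))

theorem localClosure_sup_pow {N : ℕ} (K : Ideal (PolyRing N)) (m : ℕ) :
    localClosure K ⊔ originIdeal N ^ m = K ⊔ originIdeal N ^ m :=
  le_antisymm (sup_le (localClosure_le_sup_pow K m) le_sup_right)
    (sup_le_sup_right (le_localClosure K) _)

/-- **Krull's intersection theorem** for the ideal of the origin. -/
theorem mem_localClosure_of_forall_mem_sup_pow {N : ℕ} {K : Ideal (PolyRing N)} {f : PolyRing N}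
    (h : ∀ m, f ∈ K ⊔ originIdeal N ^ m) : f ∈ localClosure K := by
  set a := algebraMap (PolyRing N) (LocalRing N)
  have key : (⨅ m : ℕ, IsLocalRing.maximalIdeal (LocalRing N) ^ m • ⊤ :
      Submodule (LocalRing N) (LocalRing N ⧸ extend K)) = ⊥ :=
    Ideal.iInf_pow_smul_eq_bot_of_isLocalRing _ (IsLocalRing.maximalIdeal.isMaximal _).ne_top
  have hmem : (Ideal.Quotient.mk (extend K) (a f)) ∈
      (⨅ m : ℕ, IsLocalRing.maximalIdeal (LocalRing N) ^ m • ⊤ :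
      Submodule (LocalRing N) (LocalRing N ⧸ extend K)) := by
    rw [Submodule.mem_iInf]
    intro m
    obtain ⟨u, hu, v, hv, huv⟩ := Submodule.mem_sup.1 (h m)
    have hu' : Ideal.Quotient.mk (extend K) (a u) = 0 :=
      Ideal.Quotient.eq_zero_iff_mem.2 (Ideal.mem_map_of_mem _ hu)
    rw [← huv, map_add, map_add, hu', zero_add]
    have hv' : a v ∈ IsLocalRing.maximalIdeal (LocalRing N) ^ m := by
      rw [← map_originIdeal_pow]
      exact Ideal.mem_map_of_mem _ hv
    have := Submodule.smul_mem_smul hv'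
      (Submodule.mem_top (x := (1 : LocalRing N ⧸ extend K)))
    have h1 : a v • (1 : LocalRing N ⧸ extend K) = Ideal.Quotient.mk (extend K) (a v) :=
      (congrArg (Ideal.Quotient.mk (extend K)) (mul_one (a v)) :)
    rwa [h1] at this
  rw [key, Submodule.mem_bot] at hmem
  exact Ideal.mem_comap.2 (Ideal.Quotient.eq_zero_iff_mem.1 hmem)

/-- Denominators are already invertible modulo 𝔪^m, so R maps onto the local quotient. This moves
the Hilbert function to the polynomial ring. -/
theorem finrank_localRing_quotient {N : ℕ} (K : Ideal (PolyRing N)) (m : ℕ) :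
    Module.finrank ℂ (LocalRing N ⧸ (extend K ⊔ IsLocalRing.maximalIdeal (LocalRing N) ^ m)) =
      Module.finrank ℂ (PolyRing N ⧸ (K ⊔ originIdeal N ^ m)) := by
  have hmap : extend K ⊔ IsLocalRing.maximalIdeal (LocalRing N) ^ m =
      extend (K ⊔ originIdeal N ^ m) := by
    rw [← map_originIdeal_pow, extend, extend, extend, Ideal.map_sup]
  rw [hmap]
  set L := K ⊔ originIdeal N ^ m with hL
  let φ : PolyRing N →ₐ[ℂ] LocalRing N ⧸ extend L :=
    (Ideal.Quotient.mkₐ ℂ (extend L)).comp (IsScalarTower.toAlgHom ℂ (PolyRing N) (LocalRing N))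
  have hφ : ∀ f, φ f = Ideal.Quotient.mk (extend L) (algebraMap (PolyRing N) (LocalRing N) f) :=
    fun f => rfl
  have hker : RingHom.ker φ = L := by
    ext f
    rw [RingHom.mem_ker, hφ, Ideal.Quotient.eq_zero_iff_mem]
    refine ⟨fun hf => ?_, fun hf => Ideal.mem_map_of_mem _ hf⟩
    have h := localClosure_le_sup_pow L m hf
    rwa [hL, sup_assoc, sup_idem] at h
  have hsurj : Function.Surjective φ := by
    intro y
    obtain ⟨y, rfl⟩ := Ideal.Quotient.mk_surjective y
    obtain ⟨r, s, rfl⟩ := IsLocalization.exists_mk'_eq (originIdeal N).primeCompl y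
    obtain ⟨t, ht⟩ := exists_mul_sub_one_mem s.2 m
    refine ⟨t * r, ?_⟩
    rw [hφ, Ideal.Quotient.eq]
    have h : algebraMap (PolyRing N) (LocalRing N) (t * r) -
        IsLocalization.mk' (LocalRing N) r s =
        IsLocalization.mk' (LocalRing N) r s *
          algebraMap (PolyRing N) (LocalRing N) (t * s - 1) := by
      have := IsLocalization.mk'_spec (LocalRing N) r s
      rw [map_mul, ← this, map_sub, map_mul, map_one]
      ring
    rw [h]
    exact Ideal.mul_mem_left _ _ (Ideal.mem_map_of_mem _ (Ideal.mem_sup_right ht))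
  have e := Ideal.quotientKerAlgEquivOfSurjective hsurj
  exact (((Ideal.quotientEquivAlgOfEq ℂ hker).symm.trans e).toLinearEquiv.finrank_eq).symm

/-! ### Curves at the origin -/

/-- A prime of R₀ containing I and x lies strictly above a minimal prime of IR₀, which omits x by
general position. Were it not maximal, there would be a chain of length two, contradicting dimension
one. -/
theorem exists_pow_le_localClosure_sup_span {N : ℕ} {I : Ideal (PolyRing N)} {i : Fin N}
    (hdim : IsCurveAtOrigin I) (hpos : InGeneralPosition I i) :
    ∃ c : ℕ, originIdeal N ^ c ≤ localClosure (I ⊔ Ideal.span {X i}) := by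
  set a := algebraMap (PolyRing N) (LocalRing N)
  have hrad : IsLocalRing.maximalIdeal (LocalRing N) ≤
      (extend (I ⊔ Ideal.span {X i})).radical := by
    rw [Ideal.radical_eq_sInf]
    refine le_sInf ?_
    rintro P ⟨hP, hPprime⟩
    have hPI : extend I ≤ P := le_trans (Ideal.map_mono le_sup_left) hP
    have hPx : a (X i) ∈ P :=
      hP (Ideal.mem_map_of_mem _ (Ideal.mem_sup_right (Ideal.mem_span_singleton_self _)))
    obtain ⟨Q, hQ, hQP⟩ := Ideal.exists_minimalPrimes_le hPI
    have hQprime : Q.IsPrime := hQ.1.1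
    have hQle : extend I ≤ Q := hQ.1.2
    have hQx : a (X i) ∉ Q := by
      have h1 : Q.under (PolyRing N) ∈ I.minimalPrimes := by
        rw [IsLocalization.minimalPrimes_map (originIdeal N).primeCompl (LocalRing N) I] at hQ
        exact hQ
      have h2 : Q.under (PolyRing N) ≤ originIdeal N := by
        exact (Ideal.comap_mono (IsLocalRing.le_maximalIdeal hQprime.ne_top)).trans
          (IsLocalization.AtPrime.under_maximalIdeal (LocalRing N) (originIdeal N)).le
      exact hpos _ h1 h2
    by_contra hne
    have hlt1 : Q < P := lt_of_le_of_ne hQP (fun h => hQx (h ▸ hPx))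
    have hlt2 : P < IsLocalRing.maximalIdeal (LocalRing N) :=
      lt_of_le_of_ne (IsLocalRing.le_maximalIdeal hPprime.ne_top) (fun h => hne h.ge)
    rw [IsCurveAtOrigin, ringKrullDim_quotient] at hdim
    let z0 : PrimeSpectrum.zeroLocus (R := LocalRing N) (extend I) := ⟨⟨Q, hQprime⟩, hQle⟩
    let z1 : PrimeSpectrum.zeroLocus (R := LocalRing N) (extend I) := ⟨⟨P, hPprime⟩, hPI⟩
    let z2 : PrimeSpectrum.zeroLocus (R := LocalRing N) (extend I) :=
      ⟨⟨IsLocalRing.maximalIdeal (LocalRing N), inferInstance⟩, hPI.trans hlt2.le⟩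
    have h01 : z0 < z1 := hlt1
    have h12 : z1 < z2 := hlt2
    let p₁ : LTSeries (PrimeSpectrum.zeroLocus (R := LocalRing N) (extend I)) :=
      (RelSeries.singleton _ z2).cons z1 h12
    let p : LTSeries (PrimeSpectrum.zeroLocus (R := LocalRing N) (extend I)) := p₁.cons z0 h01
    have hlen := Order.LTSeries.length_le_krullDim p
    rw [hdim] at hlen
    have hp : p.length = 2 := rfl
    rw [hp] at hlen
    norm_num at hlen
  obtain ⟨c, hc⟩ := Ideal.exists_pow_le_of_le_radical_of_fg hrad
    (IsNoetherian.noetherian (IsLocalRing.maximalIdeal (LocalRing N)))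
  refine ⟨c, ?_⟩
  rw [localClosure, ← Ideal.map_le_iff_le_comap]
  rwa [← map_originIdeal_pow] at hc

theorem localClosure_localClosure {N : ℕ} (K : Ideal (PolyRing N)) :
    localClosure (localClosure K) = localClosure K := by
  rw [localClosure, extend_localClosure, localClosure]

/-- A socle element h modulo J becomes one modulo I after multiplication by the product of the
denominators needed for the finitely many X i * h. -/
theorem originIdeal_mem_associatedPrimes {N : ℕ} {I : Ideal (PolyRing N)} {h : PolyRing N}
    (hh : h ∉ localClosure I) (hm : ∀ i, X i * h ∈ localClosure I) :
    originIdeal N ∈ associatedPrimes (PolyRing N) (PolyRing N ⧸ I) := by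
  choose s hs hsI using fun i => mem_localClosure_iff.1 (hm i)
  have hsprod : ∏ i, s i ∉ originIdeal N := fun hmem => by
    obtain ⟨i, -, hi⟩ := (originIdeal_isPrime N).prod_mem_iff.1 hmem
    exact hs i hi
  rw [AssociatedPrimes.mem_iff, isAssociatedPrime_iff]
  refine ⟨inferInstance, Ideal.Quotient.mk I ((∏ i, s i) * h), ?_⟩
  refine (originIdeal_isMaximal N).eq_of_le ?_ ?_
  · rw [Ideal.ne_top_iff_one, Submodule.mem_colon_singleton, one_smul, Submodule.mem_bot,
      Ideal.Quotient.eq_zero_iff_mem]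
    exact fun hmem => hh (mem_localClosure_iff.2 ⟨_, hsprod, hmem⟩)
  · refine Ideal.span_le.2 ?_
    rintro _ ⟨i, rfl⟩
    rw [SetLike.mem_coe, Submodule.mem_colon_singleton, Submodule.mem_bot]
    refine Ideal.Quotient.eq_zero_iff_mem.2 ?_
    rw [← Finset.mul_prod_erase _ _ (Finset.mem_univ i)]
    have h' : (X i : PolyRing N) * (s i * (∏ j ∈ Finset.univ.erase i, s j) * h) =
        (∏ j ∈ Finset.univ.erase i, s j) * (s i * (X i * h)) := by ring
    have hmem := Ideal.mul_mem_left I (∏ j ∈ Finset.univ.erase i, s j) (hsI i)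
    rw [← h'] at hmem
    exact hmem

/-- Non-minimality of the origin is automatic, since general position excludes x from minimal primes
inside 𝔪. For the converse, f is killed modulo J by x, hence by a power of 𝔪; the last nonzero
multiples of f are socle elements. -/
theorem originIsEmbedded_iff {N : ℕ} {I : Ideal (PolyRing N)} {i : Fin N}
    (hdim : IsCurveAtOrigin I) (hpos : InGeneralPosition I i) :
    OriginIsEmbedded I ↔ ∃ f, f ∉ localClosure I ∧ X i * f ∈ localClosure I := by
  classical
  have hX : (X i : PolyRing N) ∈ originIdeal N := Ideal.subset_span ⟨i, rfl⟩
  constructor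
  · rintro ⟨hass, -⟩
    rw [AssociatedPrimes.mem_iff, isAssociatedPrime_iff] at hass
    obtain ⟨-, y, hy⟩ := hass
    obtain ⟨f, rfl⟩ := Ideal.Quotient.mk_surjective y
    have hmem : ∀ g, g ∈ originIdeal N ↔ g * f ∈ I := by
      intro g
      rw [hy, Submodule.mem_colon_singleton, Submodule.mem_bot]
      exact Ideal.Quotient.eq_zero_iff_mem (a := g * f)
    refine ⟨f, fun hf => ?_, le_localClosure I ((hmem _).1 hX)⟩
    obtain ⟨s, hs, hsf⟩ := mem_localClosure_iff.1 hf
    exact hs ((hmem s).2 hsf)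
  · rintro ⟨f, hf, hxf⟩
    refine ⟨?_, fun h => hpos _ h le_rfl hX⟩
    have hex : ∃ c : ℕ, ∀ g ∈ originIdeal N ^ c, g * f ∈ localClosure I := by
      obtain ⟨c, hc⟩ := exists_pow_le_localClosure_sup_span hdim hpos
      refine ⟨c, fun g hg => ?_⟩
      obtain ⟨s, hs, hsg⟩ := mem_localClosure_iff.1 (hc hg)
      rw [← localClosure_localClosure]
      refine mem_localClosure_iff.2 ⟨s, hs, ?_⟩
      obtain ⟨u, hu, v, hv, huv⟩ := Submodule.mem_sup.1 hsg
      obtain ⟨w, rfl⟩ := Ideal.mem_span_singleton'.1 hv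
      rw [← mul_assoc, ← huv, add_mul, mul_assoc]
      exact add_mem (Ideal.mul_mem_right _ _ (le_localClosure I hu)) (Ideal.mul_mem_left _ _ hxf)
    have hmin := Nat.find_spec hex
    cases hc : Nat.find hex with
    | zero =>
      rw [hc] at hmin
      exact absurd (by simpa using hmin 1 (by simp)) hf
    | succ c =>
      rw [hc] at hmin
      have hnot := Nat.find_min hex (m := c) (by omega)
      push Not at hnot
      obtain ⟨g, hg, hgf⟩ := hnot
      refine originIdeal_mem_associatedPrimes hgf fun j => ?_
      rw [← mul_assoc]
      refine hmin _ ?_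
      rw [pow_succ']
      exact Ideal.mul_mem_mul (Ideal.subset_span ⟨j, rfl⟩) hg

/-! ### Macaulay's growth bound for small Hilbert functions -/

/-- If `M'` is a set of exponents of degree `d + 1` all of whose divisors of degree `d` lie in a
set `M` with at most `d` elements, then `M'` has at most as many elements as `M`. -/
theorem card_le_card_of_sub_single_mem {N : ℕ} (d : ℕ) (M M' : Finset (Fin N → ℕ))
    (hdeg : ∀ u ∈ M', ∑ i, u i = d + 1)
    (hsub : ∀ u ∈ M', ∀ i, u i ≠ 0 → u - Pi.single i 1 ∈ M)
    (hcard : M.card ≤ d) : M'.card ≤ M.card := by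
  induction N generalizing d with
  | zero =>
    rcases M'.eq_empty_or_nonempty with h | ⟨u, hu⟩
    · simp [h]
    · simpa using hdeg u hu
  | succ N ih =>
    -- Slice by the exponent a of the first variable and induct on the number of variables.
    let lev : Finset (Fin (N + 1) → ℕ) → ℕ → Finset (Fin N → ℕ) :=
      fun S a => (S.filter fun u => u 0 = a).image Fin.tail
    have mem_lev : ∀ S a v, v ∈ lev S a ↔ (Fin.cons a v : Fin (N + 1) → ℕ) ∈ S := by
      intro S a v
      simp only [lev, Finset.mem_image, Finset.mem_filter]
      constructor
      · rintro ⟨u, ⟨hu, rfl⟩, rfl⟩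
        rwa [Fin.cons_self_tail]
      · intro h
        exact ⟨_, ⟨h, by simp⟩, by simp⟩
    have card_lev : ∀ S a, (lev S a).card = (S.filter fun u => u 0 = a).card := by
      intro S a
      refine Finset.card_image_of_injOn ?_
      intro u hu v hv huv
      simp only [Finset.coe_filter, Set.mem_ofPred_eq] at hu hv
      rw [← Fin.cons_self_tail u, ← Fin.cons_self_tail v, huv, hu.2, hv.2]
    have sum_lev : ∀ S n, ∑ a ∈ Finset.range n, (lev S a).card =
        (S.filter fun u => u 0 ∈ Finset.range n).card := by
      intro S n
      simp only [card_lev]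
      exact Finset.sum_card_fiberwise_eq_card_filter _ _ _
    have sub_lev : ∀ a v, v ∈ lev M' a → ∀ i, v i ≠ 0 → v - Pi.single i 1 ∈ lev M a := by
      intro a v hv i hi
      rw [mem_lev] at hv ⊢
      have h := hsub _ hv i.succ (by simpa using hi)
      convert h using 1
      ext j
      refine Fin.cases ?_ (fun j => ?_) j
      · simp
      · by_cases hj : j = i
        · subst hj; simp
        · simp [hj]
    have deg_lev : ∀ a v, v ∈ lev M' a → a + ∑ i, v i = d + 1 := by
      intro a v hv
      rw [mem_lev] at hv
      simpa [Fin.sum_univ_succ] using hdeg _ hv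
    have succ_lev : ∀ a, lev M' (a + 1) ⊆ lev M a := by
      intro a v hv
      rw [mem_lev] at hv ⊢
      have h := hsub _ hv 0 (by simp)
      convert h using 1
      ext j
      refine Fin.cases ?_ (fun j => ?_) j <;> simp
    -- The levels 0, …, d cannot all be occupied by at most d exponents.
    have hex : ∃ a, lev M a = ∅ := by
      by_contra! hne
      have h1 : ∑ a ∈ Finset.range (d + 1), 1 ≤ ∑ a ∈ Finset.range (d + 1), (lev M a).card :=
        Finset.sum_le_sum fun a _ => Finset.card_pos.2 (hne a)
      rw [sum_lev] at h1
      have h2 := Finset.card_filter_le M fun u => u 0 ∈ Finset.range (d + 1)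
      simp at h1
      simp at h2
      omega
    set a := Nat.find hex
    have hempty : lev M a = ∅ := Nat.find_spec hex
    have hpos : ∀ b < a, 1 ≤ (lev M b).card := fun b hb =>
      Finset.card_pos.2 (Finset.nonempty_iff_ne_empty.2 (Nat.find_min hex hb))
    -- The b nonempty levels below b use up at least b elements of M, so level b meets the
    -- cardinality bound d - b required by induction.
    have hlow : ∀ b < a, b + (lev M b).card ≤ d := by
      intro b hb
      have h1 : ∑ c ∈ Finset.range b, 1 ≤ ∑ c ∈ Finset.range b, (lev M c).card :=
        Finset.sum_le_sum fun c hc => hpos c ((Finset.mem_range.1 hc).trans hb)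
      have h2 := sum_lev M (b + 1)
      have h3 := Finset.card_filter_le M fun u => u 0 ∈ Finset.range (b + 1)
      rw [Finset.sum_range_succ] at h2
      rw [Finset.sum_const, Finset.card_range, smul_eq_mul, mul_one] at h1
      omega
    have hle : ∀ b < a, (lev M' b).card ≤ (lev M b).card := by
      intro b hb
      have h1 := hlow b hb
      refine ih (d - b) _ _ (fun v hv => ?_) (sub_lev b) (by omega)
      have := deg_lev b v hv
      omega
    have had : a ≤ d := by
      by_contra hlt
      have h1 := hlow d (by omega)
      have h2 := hpos d (by omega)
      omega
    have hempty' : (lev M' a).card = 0 := by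
      rw [Finset.card_eq_zero, Finset.eq_empty_iff_forall_notMem]
      intro v hv
      have h1 := deg_lev a v hv
      obtain ⟨i, hi⟩ : ∃ i, v i ≠ 0 := by
        by_contra! hall
        simp only [hall, Finset.sum_const_zero] at h1
        omega
      have h2 := sub_lev a v hv i hi
      rw [hempty] at h2
      exact absurd h2 (Finset.notMem_empty _)
    -- Below the gap a, levels are compared with equal index. Level a of M' is empty, so above it
    -- level b + 1 of M' may be compared with level b of M.
    have hstep : ∀ n, a ≤ n → ∑ b ∈ Finset.range (n + 1), (lev M' b).card ≤
        ∑ b ∈ Finset.range n, (lev M b).card := by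
      intro n hn
      induction n, hn using Nat.le_induction with
      | base =>
        rw [Finset.sum_range_succ, hempty', add_zero]
        exact Finset.sum_le_sum fun b hb => hle b (Finset.mem_range.1 hb)
      | succ n _ ihn =>
        rw [Finset.sum_range_succ, Finset.sum_range_succ (fun b => (lev M b).card)]
        exact add_le_add ihn (Finset.card_le_card (succ_lev n))
    have htot := hstep (d + 1) (by omega)
    rw [sum_lev, sum_lev] at htot
    have hM' : (M'.filter fun u => u 0 ∈ Finset.range (d + 1 + 1)) = M' := by
      refine Finset.filter_true_of_mem fun u hu => ?_
      have h1 := hdeg u hu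
      rw [Fin.sum_univ_succ] at h1
      exact Finset.mem_range.2 (by omega)
    rw [hM'] at htot
    exact htot.trans (Finset.card_filter_le _ _)

/-! ### Standard monomials -/

theorem finrank_quotient_eq_of_sup_span_singleton {V : Type*} [AddCommGroup V] [Module ℂ V]
    (P : Submodule ℂ V) [Module.Finite ℂ (V ⧸ P)] (v : V) [Decidable (v ∈ P)] :
    Module.finrank ℂ (V ⧸ P) =
      Module.finrank ℂ (V ⧸ (P ⊔ Submodule.span ℂ {v})) + if v ∈ P then 0 else 1 := by
  have h1 := (P.quotientQuotientEquivQuotientSup (Submodule.span ℂ {v})).finrank_eq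
  have h2 := Submodule.finrank_quotient_add_finrank ((Submodule.span ℂ {v}).map P.mkQ)
  rw [← h2, h1, Submodule.map_span, Set.image_singleton]
  congr 1
  split_ifs with h
  · rw [(Submodule.Quotient.mk_eq_zero P).2 h |> fun h => (h : P.mkQ v = 0)]
    simp
  · exact finrank_span_singleton fun h0 => h ((Submodule.Quotient.mk_eq_zero P).1 h0)

-- Adjoin the vectors in increasing order: each lowers the codimension by one exactly when it is not
-- in the span of P and its predecessors.
open Classical in
theorem finrank_quotient_eq_add_card {V ι : Type*} [AddCommGroup V] [Module ℂ V] [LinearOrder ι]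
    (P : Submodule ℂ V) [Module.Finite ℂ (V ⧸ P)] (v : ι → V) (s : Finset ι) :
    Module.finrank ℂ (V ⧸ P) = Module.finrank ℂ (V ⧸ (P ⊔ Submodule.span ℂ (v '' s))) +
      (s.filter fun a => v a ∉ P ⊔ Submodule.span ℂ (v '' {b | b ∈ s ∧ b < a})).card := by
  induction s using Finset.induction_on_max with
  | empty =>
    rw [Finset.coe_empty, Set.image_empty, Submodule.span_empty, sup_bot_eq]
    simp
  | insert a s hlt ih =>
    have ha : a ∉ s := fun h => lt_irrefl _ (hlt a h)
    set P' := P ⊔ Submodule.span ℂ (v '' (s : Set ι)) with hP'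
    have hfin : Module.Finite ℂ (V ⧸ P') :=
      Module.Finite.of_surjective (Submodule.factor (le_sup_left : P ≤ P'))
        (Submodule.factor_surjective _)
    have h1 : P ⊔ Submodule.span ℂ (v '' ((insert a s : Finset ι) : Set ι)) =
        P' ⊔ Submodule.span ℂ {v a} := by
      rw [Finset.coe_insert, Set.image_insert_eq, Submodule.span_insert, hP', sup_assoc,
        sup_comm (Submodule.span ℂ {v a})]
    have h2 : {b | b ∈ insert a s ∧ b < a} = (s : Set ι) := by
      ext b
      simp only [Finset.mem_insert, Set.mem_ofPred_eq, Finset.mem_coe]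
      exact ⟨fun h => h.1.resolve_left h.2.ne, fun h => ⟨Or.inr h, hlt b h⟩⟩
    have h3 : (s.filter fun c => v c ∉ P ⊔ Submodule.span ℂ (v '' {b | b ∈ insert a s ∧ b < c})) =
        s.filter fun c => v c ∉ P ⊔ Submodule.span ℂ (v '' {b | b ∈ s ∧ b < c}) := by
      refine Finset.filter_congr fun c hc => ?_
      have : {b | b ∈ insert a s ∧ b < c} = {b | b ∈ s ∧ b < c} := by
        ext b
        simp only [Finset.mem_insert, Set.mem_ofPred_eq]
        exact ⟨fun h => ⟨h.1.resolve_left fun e => lt_asymm h.2 (e ▸ hlt c hc), h.2⟩,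
          fun h => ⟨Or.inr h.1, h.2⟩⟩
      rw [this]
    rw [h1, ih, finrank_quotient_eq_of_sup_span_singleton P' (v a), Finset.filter_insert, h2, h3]
    by_cases h : v a ∈ P'
    · rw [if_pos h, if_neg (not_not.2 h), add_zero]
    · have hna : a ∉ s.filter fun c => v c ∉ P ⊔ Submodule.span ℂ (v '' {b | b ∈ s ∧ b < c}) :=
        fun h => ha (Finset.mem_filter.1 h).1
      rw [if_neg h, if_pos h, Finset.card_insert_of_notMem hna]
      omega

/-- The dimension of `R / (K + 𝔪^j)`. -/
def codimPow {N : ℕ} (K : Ideal (PolyRing N)) (j : ℕ) : ℕ :=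
  Module.finrank ℂ (PolyRing N ⧸ (K ⊔ originIdeal N ^ j))

instance finite_quotient_originIdeal_pow (N j : ℕ) :
    Module.Finite ℂ (PolyRing N ⧸ originIdeal N ^ j) := by
  classical
  have hfin : {α : Fin N →₀ ℕ | α.degree ≤ j}.Finite := Finsupp.finite_of_degree_le j
  refine ⟨⟨hfin.toFinset.image fun α => Ideal.Quotient.mk _ (monomial α 1), ?_⟩⟩
  rw [eq_top_iff]
  rintro y -
  obtain ⟨f, rfl⟩ := Ideal.Quotient.mk_surjective y
  induction f using MvPolynomial.induction_on' with
  | monomial α c =>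
    have h : (monomial α c : PolyRing N) = c • monomial α 1 := by simp [smul_monomial]
    rw [h]
    change c • (Ideal.Quotient.mk (originIdeal N ^ j) (monomial α 1)) ∈ _
    refine Submodule.smul_mem _ _ ?_
    by_cases hα : α.degree ≤ j
    · refine Submodule.subset_span ?_
      simp only [Finset.coe_image, Set.Finite.coe_toFinset]
      exact ⟨α, hα, rfl⟩
    · rw [Ideal.Quotient.eq_zero_iff_mem.2
        ((monomial_mem_pow_idealOfVars_iff _ _ one_ne_zero).2 (by omega))]
      exact zero_mem _
  | add p q hp hq =>
    rw [map_add]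
    exact add_mem hp hq

theorem finite_quotient_of_pow_le {N j : ℕ} {K : Ideal (PolyRing N)} (h : originIdeal N ^ j ≤ K) :
    Module.Finite ℂ (PolyRing N ⧸ K) :=
  Module.Finite.of_surjective (Ideal.Quotient.factorₐ ℂ h).toLinearMap
    (Ideal.Quotient.factor_surjective h)

theorem finrank_quotient_le_of_le {N j : ℕ} {K K' : Ideal (PolyRing N)}
    (h : originIdeal N ^ j ≤ K) (hK : K ≤ K') :
    Module.finrank ℂ (PolyRing N ⧸ K') ≤ Module.finrank ℂ (PolyRing N ⧸ K) := by
  have := finite_quotient_of_pow_le h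
  exact LinearMap.finrank_le_finrank_of_surjective (f := (Ideal.Quotient.factorₐ ℂ hK).toLinearMap)
    (Ideal.Quotient.factor_surjective hK)

theorem eq_of_le_of_finrank_quotient_le {N j : ℕ} {K K' : Ideal (PolyRing N)}
    (h : originIdeal N ^ j ≤ K) (hK : K ≤ K')
    (hfin : Module.finrank ℂ (PolyRing N ⧸ K) ≤ Module.finrank ℂ (PolyRing N ⧸ K')) :
    K = K' := by
  have := finite_quotient_of_pow_le h
  have := finite_quotient_of_pow_le (h.trans hK)
  have hsurj : Function.Surjective (Ideal.Quotient.factorₐ ℂ hK).toLinearMap :=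
    Ideal.Quotient.factor_surjective hK
  have hinj := (LinearMap.injective_iff_surjective_of_finrank_eq_finrank
    (le_antisymm hfin (finrank_quotient_le_of_le h hK))).2 hsurj
  refine le_antisymm hK fun f hf => ?_
  rw [← Ideal.Quotient.eq_zero_iff_mem]
  refine hinj ?_
  rw [map_zero]
  exact Ideal.Quotient.eq_zero_iff_mem.2 hf

/-- The set of monomials of degree `j` that precede `x^α` in the lexicographic order. -/
def lowerMonomials {N : ℕ} (j : ℕ) (α : Fin N →₀ ℕ) : Set (PolyRing N) :=
  (fun β => monomial β 1) '' {β | β ∈ Finset.finsuppAntidiag Finset.univ j ∧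
    MonomialOrder.lex.toSyn β < MonomialOrder.lex.toSyn α}

open Classical in
/-- The exponents `α` of degree `j` for which `x^α` is not congruent to a combination of preceding
monomials of degree `j` modulo `K + 𝔪^{j+1}`. -/
def stdMonomials {N : ℕ} (K : Ideal (PolyRing N)) (j : ℕ) : Finset (Fin N →₀ ℕ) :=
  (Finset.finsuppAntidiag Finset.univ j).filter fun α =>
    (monomial α 1 : PolyRing N) ∉ (K ⊔ originIdeal N ^ (j + 1)).restrictScalars ℂ ⊔
      Submodule.span ℂ (lowerMonomials j α)

theorem mem_stdMonomials_iff {N : ℕ} {K : Ideal (PolyRing N)} {j : ℕ} {α : Fin N →₀ ℕ} :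
    α ∈ stdMonomials K j ↔ α ∈ Finset.finsuppAntidiag Finset.univ j ∧
      (monomial α 1 : PolyRing N) ∉ (K ⊔ originIdeal N ^ (j + 1)).restrictScalars ℂ ⊔
        Submodule.span ℂ (lowerMonomials j α) := by
  classical
  rw [stdMonomials, Finset.mem_filter]

theorem restrictScalars_sup_span_monomials {N : ℕ} (K : Ideal (PolyRing N)) (j : ℕ) :
    (K ⊔ originIdeal N ^ (j + 1)).restrictScalars ℂ ⊔
      Submodule.span ℂ ((fun β => (monomial β 1 : PolyRing N)) ''
        (Finset.finsuppAntidiag Finset.univ j : Finset (Fin N →₀ ℕ))) =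
      (K ⊔ originIdeal N ^ j).restrictScalars ℂ := by
  apply le_antisymm
  · refine sup_le ?_ ?_
    · exact sup_le_sup_left (Ideal.pow_le_pow_right (Nat.le_succ j)) K
    · rw [Submodule.span_le]
      rintro _ ⟨β, hβ, rfl⟩
      refine Ideal.mem_sup_right ((monomial_mem_pow_idealOfVars_iff _ _ one_ne_zero).2 ?_)
      rw [Finset.mem_coe, Finset.mem_finsuppAntidiag] at hβ
      rw [Finsupp.degree_eq_sum, hβ.1]
  · intro f hf
    obtain ⟨u, hu, v, hv, rfl⟩ := Submodule.mem_sup.1 hf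
    refine add_mem (Submodule.mem_sup_left (Ideal.mem_sup_left hu)) ?_
    rw [v.as_sum]
    refine Submodule.sum_mem _ fun β hβ => ?_
    have hdeg := (mem_pow_idealOfVars_iff _ _).1 hv β hβ
    have hmon : (monomial β (coeff β v) : PolyRing N) = coeff β v • monomial β 1 := by
      simp [smul_monomial]
    rw [hmon]
    refine Submodule.smul_mem _ _ ?_
    rcases hdeg.eq_or_lt with h | h
    · refine Submodule.mem_sup_right (Submodule.subset_span ⟨β, ?_, rfl⟩)
      rw [Finset.mem_coe, Finset.mem_finsuppAntidiag]
      rw [Finsupp.degree_eq_sum] at h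
      exact ⟨h.symm, Finset.subset_univ _⟩
    · exact Submodule.mem_sup_left (Ideal.mem_sup_right
        ((monomial_mem_pow_idealOfVars_iff _ _ one_ne_zero).2 h))

theorem codimPow_succ {N : ℕ} (K : Ideal (PolyRing N)) (j : ℕ) :
    codimPow K (j + 1) = codimPow K j + (stdMonomials K j).card := by
  classical
  let P := (K ⊔ originIdeal N ^ (j + 1)).restrictScalars ℂ
  have hP := (Submodule.Quotient.restrictScalarsEquiv ℂ (K ⊔ originIdeal N ^ (j + 1))).finrank_eq
  have hfin : Module.Finite ℂ (PolyRing N ⧸ P) :=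
    have := finite_quotient_of_pow_le (le_sup_right : originIdeal N ^ (j + 1) ≤ K ⊔ _)
    Module.Finite.equiv
      (Submodule.Quotient.restrictScalarsEquiv ℂ (K ⊔ originIdeal N ^ (j + 1))).symm
  let e : (Fin N →₀ ℕ) ≃+ MonomialOrder.lex.syn := MonomialOrder.lex.toSyn
  have key := finrank_quotient_eq_add_card P (fun β => (monomial (e.symm β) 1 : PolyRing N))
    ((Finset.finsuppAntidiag Finset.univ j).map e.toEquiv.toEmbedding)
  have h1 : (fun β => (monomial (e.symm β) 1 : PolyRing N)) ''
      ((Finset.finsuppAntidiag Finset.univ j).map e.toEquiv.toEmbedding :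
        Finset MonomialOrder.lex.syn) =
      (fun β => (monomial β 1 : PolyRing N)) ''
        (Finset.finsuppAntidiag Finset.univ j : Finset (Fin N →₀ ℕ)) := by
    rw [Finset.coe_map, Set.image_image]
    simp
  rw [h1, restrictScalars_sup_span_monomials] at key
  have h2 := (Submodule.Quotient.restrictScalarsEquiv ℂ (K ⊔ originIdeal N ^ j)).finrank_eq
  rw [codimPow, codimPow, ← hP, key, h2, Finset.filter_map, Finset.card_map]
  refine congrArg (fun t => _ + Finset.card t) (Finset.ext fun α => ?_)
  rw [Finset.mem_filter, mem_stdMonomials_iff]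
  have h3 : (fun β => (monomial (e.symm β) 1 : PolyRing N)) '' {b | b ∈
      (Finset.finsuppAntidiag Finset.univ j).map e.toEquiv.toEmbedding ∧ b < e.toEquiv α} =
      lowerMonomials j α := by
    ext f
    constructor
    · rintro ⟨b, ⟨hb, hlt⟩, rfl⟩
      obtain ⟨β, hβ, rfl⟩ := Finset.mem_map.1 hb
      exact ⟨β, ⟨hβ, hlt⟩, by simp⟩
    · rintro ⟨β, ⟨hβ, hlt⟩, rfl⟩
      exact ⟨e β, ⟨Finset.mem_map_of_mem _ hβ, hlt⟩, by simp⟩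
  have h4 : e.symm (e.toEquiv α) = α := e.symm_apply_apply α
  simp only [Function.comp, Equiv.coe_toEmbedding]
  rw [h3, h4]

theorem stdMonomials_anti {N : ℕ} {K K' : Ideal (PolyRing N)} (h : K ≤ K') (j : ℕ) :
    stdMonomials K' j ⊆ stdMonomials K j := by
  intro α hα
  rw [mem_stdMonomials_iff] at hα ⊢
  refine ⟨hα.1, fun hmem => hα.2 ?_⟩
  have hle : (K ⊔ originIdeal N ^ (j + 1)).restrictScalars ℂ ≤
      (K' ⊔ originIdeal N ^ (j + 1)).restrictScalars ℂ := sup_le_sup_right h _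
  exact sup_le_sup_right hle _ hmem

/-- Multiplication by a variable preserves the lexicographic order, so a relation expressing a
monomial by smaller ones passes to its multiples. This supplies the divisor hypothesis of the
combinatorial bound. -/
theorem tsub_single_mem_stdMonomials {N : ℕ} {K : Ideal (PolyRing N)} {j : ℕ} {α : Fin N →₀ ℕ}
    (hα : α ∈ stdMonomials K (j + 1)) {i : Fin N} (hi : α i ≠ 0) :
    α - Finsupp.single i 1 ∈ stdMonomials K j := by
  rw [mem_stdMonomials_iff] at hα ⊢
  obtain ⟨hα, hstd⟩ := hα
  have hsplit : α - Finsupp.single i 1 + Finsupp.single i 1 = α :=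
    tsub_add_cancel_of_le (Finsupp.single_le_iff.2 (Nat.one_le_iff_ne_zero.2 hi))
  set α' := α - Finsupp.single i 1 with hα'
  have hdeg : ∀ (β : Fin N →₀ ℕ) (m : ℕ), β ∈ Finset.finsuppAntidiag Finset.univ m ↔
      β.degree = m := by
    intro β m
    rw [Finset.mem_finsuppAntidiag, Finsupp.degree_eq_sum]
    simp
  have hα'd : α'.degree = j := by
    rw [hdeg, ← hsplit, map_add, Finsupp.degree_single] at hα
    omega
  refine ⟨(hdeg _ _).2 hα'd, fun hmem => hstd ?_⟩
  rw [← hsplit]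
  have hle : (K ⊔ originIdeal N ^ (j + 1)).restrictScalars ℂ ⊔
      Submodule.span ℂ (lowerMonomials j α') ≤
      ((K ⊔ originIdeal N ^ (j + 1 + 1)).restrictScalars ℂ ⊔
        Submodule.span ℂ (lowerMonomials (j + 1) (α' + Finsupp.single i 1))).comap
        (LinearMap.mulRight ℂ (X i : PolyRing N)) := by
    refine sup_le ?_ ?_
    · intro f hf
      refine Submodule.mem_sup_left ?_
      obtain ⟨u, hu, v, hv, rfl⟩ := Submodule.mem_sup.1 hf
      rw [LinearMap.mulRight_apply, add_mul]
      refine add_mem (Ideal.mem_sup_left (Ideal.mul_mem_right _ _ hu)) (Ideal.mem_sup_right ?_)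
      rw [pow_succ]
      exact Ideal.mul_mem_mul hv (Ideal.subset_span ⟨i, rfl⟩)
    · rw [Submodule.span_le]
      rintro _ ⟨β, ⟨hβ, hlt⟩, rfl⟩
      refine Submodule.mem_sup_right (Submodule.subset_span
        ⟨β + Finsupp.single i 1, ⟨?_, ?_⟩, ?_⟩)
      · rw [hdeg] at hβ ⊢
        rw [map_add, Finsupp.degree_single, hβ]
      · rw [map_add, map_add]
        exact add_lt_add_left hlt _
      · simp [X, monomial_mul]
  have := hle hmem
  rw [Submodule.mem_comap, LinearMap.mulRight_apply, X, monomial_mul, one_mul] at this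
  exact this

/-- Macaulay's growth bound in the case where the Hilbert function does not exceed the degree. -/
theorem card_stdMonomials_succ_le {N : ℕ} {K : Ideal (PolyRing N)} {j : ℕ}
    (h : (stdMonomials K j).card ≤ j) :
    (stdMonomials K (j + 1)).card ≤ (stdMonomials K j).card := by
  let e : (Fin N →₀ ℕ) ↪ (Fin N → ℕ) := Finsupp.equivFunOnFinite.toEmbedding
  rw [← Finset.card_map e, ← Finset.card_map e]
  refine card_le_card_of_sub_single_mem j _ _ ?_ ?_ (by rwa [Finset.card_map])
  · intro u hu
    obtain ⟨α, hα, rfl⟩ := Finset.mem_map.1 hu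
    rw [mem_stdMonomials_iff, Finset.mem_finsuppAntidiag] at hα
    exact hα.1.1
  · intro u hu i hi
    obtain ⟨α, hα, rfl⟩ := Finset.mem_map.1 hu
    refine Finset.mem_map.2 ⟨_, tsub_single_mem_stdMonomials hα hi, ?_⟩
    ext j
    simp [e, Finsupp.single_apply, Pi.single_apply, eq_comm]

theorem card_stdMonomials_le_of_le {N : ℕ} {K : Ideal (PolyRing N)} {j j' : ℕ} (hj : j ≤ j')
    (h : (stdMonomials K j).card ≤ j) :
    (stdMonomials K j').card ≤ (stdMonomials K j).card := by
  induction j', hj using Nat.le_induction with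
  | base => exact le_rfl
  | succ n hn ih => exact (card_stdMonomials_succ_le (by omega)).trans ih

/-- Adding K' ∩ 𝔪^j to K changes nothing modulo 𝔪^j, and equal counts in degree j rule out any
change modulo 𝔪^{j+1}. -/
theorem inf_pow_le_of_card_stdMonomials_le {N : ℕ} {K K' : Ideal (PolyRing N)} (hK : K ≤ K')
    {j : ℕ} (h : (stdMonomials K j).card ≤ (stdMonomials K' j).card) :
    K' ⊓ originIdeal N ^ j ≤ K ⊔ originIdeal N ^ (j + 1) := by
  set L := K ⊔ K' ⊓ originIdeal N ^ j with hL
  have hLK' : L ≤ K' := sup_le hK inf_le_left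
  have h1 : (stdMonomials K j).card ≤ (stdMonomials L j).card :=
    h.trans (Finset.card_le_card (stdMonomials_anti hLK' j))
  have h2 : codimPow L j = codimPow K j := by
    have : L ⊔ originIdeal N ^ j = K ⊔ originIdeal N ^ j :=
      le_antisymm (sup_le (sup_le le_sup_left (inf_le_right.trans le_sup_right)) le_sup_right)
        (sup_le_sup_right le_sup_left _)
    rw [codimPow, codimPow, this]
  have h3 := codimPow_succ K j
  have h4 := codimPow_succ L j
  have h5 := eq_of_le_of_finrank_quotient_le (j := j + 1)
    (le_sup_right : _ ≤ K ⊔ originIdeal N ^ (j + 1))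
    (sup_le_sup_right (le_sup_left : K ≤ L) (originIdeal N ^ (j + 1)))
    (by change codimPow K (j + 1) ≤ codimPow L (j + 1); omega)
  rw [h5]
  exact (le_sup_right.trans (le_sup_left : L ≤ _))

/-! ### The Hilbert function of a curve -/

/-- The ideal `K : x` of all `f` with `x f ∈ K`. -/
def colonElement {N : ℕ} (K : Ideal (PolyRing N)) (x : PolyRing N) : Ideal (PolyRing N) :=
  Submodule.comap (LinearMap.mulLeft (PolyRing N) x) K

theorem le_colonElement {N : ℕ} (K : Ideal (PolyRing N)) (x : PolyRing N) :
    K ≤ colonElement K x := fun _ hf => Ideal.mul_mem_left _ _ hf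

/-- Exactness of R/(P : x) → R/P → R/(P + (x)) → 0, the first map being multiplication by x. -/
theorem finrank_quotient_le_add_colonElement {N j : ℕ} {P : Ideal (PolyRing N)}
    (hP : originIdeal N ^ j ≤ P) (x : PolyRing N) :
    Module.finrank ℂ (PolyRing N ⧸ P) ≤ Module.finrank ℂ (PolyRing N ⧸ (P ⊔ Ideal.span {x})) +
      Module.finrank ℂ (PolyRing N ⧸ colonElement P x) := by
  have := finite_quotient_of_pow_le hP
  have := finite_quotient_of_pow_le (hP.trans (le_colonElement P x))
  let φ : (PolyRing N ⧸ colonElement P x) →ₗ[ℂ] PolyRing N ⧸ P :=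
    (Submodule.mapQ (colonElement P x) P (LinearMap.mulLeft (PolyRing N) x) le_rfl).restrictScalars ℂ
  let ψ : (PolyRing N ⧸ P) →ₗ[ℂ] PolyRing N ⧸ (P ⊔ Ideal.span {x}) :=
    (Ideal.Quotient.factorₐ ℂ le_sup_left).toLinearMap
  have hψ : Function.Surjective ψ := Ideal.Quotient.factor_surjective le_sup_left
  have hker : LinearMap.ker ψ ≤ LinearMap.range φ := by
    intro y hy
    obtain ⟨f, rfl⟩ := Ideal.Quotient.mk_surjective y
    have hf : f ∈ P ⊔ Ideal.span {x} := Ideal.Quotient.eq_zero_iff_mem.1 hy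
    obtain ⟨u, hu, v, hv, rfl⟩ := Submodule.mem_sup.1 hf
    obtain ⟨g, rfl⟩ := Ideal.mem_span_singleton'.1 hv
    refine ⟨Ideal.Quotient.mk _ g, ?_⟩
    change Ideal.Quotient.mk P (x * g) = _
    rw [map_add, Ideal.Quotient.eq_zero_iff_mem.2 hu, zero_add, mul_comm]
  have h1 := LinearMap.finrank_range_add_finrank_ker ψ
  rw [LinearMap.range_eq_top.2 hψ, finrank_top] at h1
  have h2 := Submodule.finrank_mono hker
  have h3 := LinearMap.finrank_range_le φ
  omega

theorem codimPow_succ_le {N c : ℕ} {K : Ideal (PolyRing N)} {x : PolyRing N}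
    (hx : x ∈ originIdeal N) (hc : ∀ n, originIdeal N ^ c ≤ K ⊔ Ideal.span {x} ⊔ originIdeal N ^ n)
    (n : ℕ) :
    codimPow K (n + 1) ≤ Module.finrank ℂ (PolyRing N ⧸ originIdeal N ^ c) +
      codimPow (colonElement K x) n := by
  refine (finrank_quotient_le_add_colonElement (le_sup_right : _ ≤ K ⊔ originIdeal N ^ (n + 1))
    x).trans (add_le_add (finrank_quotient_le_of_le le_rfl ?_)
      (finrank_quotient_le_of_le (j := n) le_sup_right ?_))
  · rw [sup_right_comm]
    exact hc (n + 1)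
  · refine sup_le (fun f hf => Ideal.mem_sup_left hf) fun f hf => Ideal.mem_sup_right ?_
    rw [LinearMap.mulLeft_apply, pow_succ']
    exact Ideal.mul_mem_mul hx hf

theorem codimPow_anti {N : ℕ} {K K' : Ideal (PolyRing N)} (h : K ≤ K') (n : ℕ) :
    codimPow K' n ≤ codimPow K n :=
  finrank_quotient_le_of_le (j := n) le_sup_right (sup_le_sup_right h _)

/-- The Hilbert function is bounded by l = dim R/𝔪^c, so in degrees at least l the growth bound
makes it non-increasing. Its least value there is permanent. -/
theorem exists_card_stdMonomials_eq {N c : ℕ} {K : Ideal (PolyRing N)} {x : PolyRing N}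
    (hx : x ∈ originIdeal N)
    (hc : ∀ n, originIdeal N ^ c ≤ K ⊔ Ideal.span {x} ⊔ originIdeal N ^ n) :
    ∃ μ n₀, ∀ n, n₀ ≤ n → (stdMonomials K n).card = μ := by
  classical
  set l := Module.finrank ℂ (PolyRing N ⧸ originIdeal N ^ c)
  have hbound : ∀ n, (stdMonomials K n).card ≤ l := fun n => by
    have h1 := codimPow_succ_le hx hc n
    have h2 := codimPow_anti (le_colonElement K x) n
    have h3 := codimPow_succ K n
    omega
  have hex : ∃ v n, l ≤ n ∧ (stdMonomials K n).card = v := ⟨_, l, le_rfl, rfl⟩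
  obtain ⟨n₀, hn₀, hv⟩ := Nat.find_spec hex
  refine ⟨_, n₀, fun n hn => le_antisymm ?_ (Nat.find_min' hex ⟨n, hn₀.trans hn, rfl⟩)⟩
  rw [← hv]
  exact card_stdMonomials_le_of_le hn ((hbound n₀).trans hn₀)

/-- A value below μ ≤ k + 1 is at most n, so it can never rise again; the codimensions for K : x
would then lag behind those for K without bound. -/
theorem le_card_stdMonomials_colonElement {N c : ℕ} {K : Ideal (PolyRing N)} {x : PolyRing N}
    (hx : x ∈ originIdeal N)
    (hc : ∀ n, originIdeal N ^ c ≤ K ⊔ Ideal.span {x} ⊔ originIdeal N ^ n) {μ k : ℕ}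
    (hμ : ∀ n, k ≤ n → (stdMonomials K n).card = μ) (hk : μ ≤ k + 1) {n : ℕ} (hn : k ≤ n) :
    μ ≤ (stdMonomials (colonElement K x) n).card := by
  by_contra! hlt
  have h1 : ∀ t, codimPow (colonElement K x) (n + t) + t ≤
      codimPow (colonElement K x) n + t * μ := by
    intro t
    induction t with
    | zero => simp
    | succ t ih =>
      have h2 := codimPow_succ (colonElement K x) (n + t)
      have h3 := card_stdMonomials_le_of_le (Nat.le_add_right n t)
        (show (stdMonomials (colonElement K x) n).card ≤ n by omega)
      rw [← add_assoc n, h2, add_mul]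
      omega
  have h2 : ∀ t, codimPow K (n + t) = codimPow K n + t * μ := by
    intro t
    induction t with
    | zero => simp
    | succ t ih =>
      rw [← add_assoc, codimPow_succ, ih, hμ _ (by omega), add_mul, one_mul, add_assoc]
  -- After t steps the lag is at least t, which exhausts the constant allowed by `codimPow_succ_le`
  -- and the starting codimension.
  set t := Module.finrank ℂ (PolyRing N ⧸ originIdeal N ^ c) + codimPow (colonElement K x) n
    with ht
  have h3 := codimPow_succ_le hx hc (n + t)
  have h4 := h1 t
  have h5 := h2 (t + 1)
  rw [← add_assoc, add_mul] at h5
  omega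

/-- Since K and K : x agree in every degree n ≥ k, the part of an element lying in 𝔪^n can be pushed
into 𝔪^{n+1} modulo K, one degree at a time. -/
theorem colonElement_inf_sup_pow_le {N c : ℕ} {K : Ideal (PolyRing N)} {x : PolyRing N}
    (hx : x ∈ originIdeal N)
    (hc : ∀ n, originIdeal N ^ c ≤ K ⊔ Ideal.span {x} ⊔ originIdeal N ^ n) {μ k : ℕ}
    (hμ : ∀ n, k ≤ n → (stdMonomials K n).card = μ) (hk : μ ≤ k + 1) {n : ℕ} (hn : k ≤ n) :
    colonElement K x ⊓ (K ⊔ originIdeal N ^ k) ≤ K ⊔ originIdeal N ^ n := by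
  induction n, hn using Nat.le_induction with
  | base => exact inf_le_right
  | succ n hn ih =>
    intro z hz
    obtain ⟨u, hu, v, hv, rfl⟩ := Submodule.mem_sup.1 (ih hz)
    refine add_mem (Ideal.mem_sup_left hu) ?_
    refine inf_pow_le_of_card_stdMonomials_le (le_colonElement K x) ?_ ⟨?_, hv⟩
    · rw [hμ n hn]
      exact le_card_stdMonomials_colonElement hx hc hμ hk hn
    · exact (Submodule.add_mem_iff_right _ (le_colonElement K x hu)).1 hz.1

/-! ### Regularity index and multiplicity from standard monomial counts -/

theorem hilbertFunction_extend {N : ℕ} (I : Ideal (PolyRing N)) (j : ℕ) :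
    hilbertFunction (extend I) j = (stdMonomials I j).card := by
  have h := codimPow_succ I j
  rw [codimPow, codimPow] at h
  rw [hilbertFunction, finrank_localRing_quotient, finrank_localRing_quotient, h]
  push_cast
  ring

theorem hilbertPolynomial_eq_C {N : ℕ} {J : Ideal (LocalRing N)} {μ n₀ : ℕ}
    (h : ∀ n, n₀ ≤ n → hilbertFunction J n = μ) : hilbertPolynomial J = Polynomial.C (μ : ℚ) := by
  have hev : ∀ᶠ n : ℕ in Filter.atTop, hilbertFunction J n = μ :=
    Filter.eventually_atTop.2 ⟨n₀, h⟩
  have hex : ∃ P : Polynomial ℚ, ∀ᶠ k : ℕ in Filter.atTop,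
      (hilbertFunction J k : ℚ) = P.eval (k : ℚ) := by
    refine ⟨Polynomial.C (μ : ℚ), hev.mono fun n hn => ?_⟩
    rw [hn, Polynomial.eval_C, Int.cast_natCast]
  rw [hilbertPolynomial, dif_pos hex]
  refine Polynomial.eq_of_infinite_eval_eq _ _ ?_
  obtain ⟨n₁, hn₁⟩ := Filter.eventually_atTop.1 (hev.and hex.choose_spec)
  refine Set.Infinite.mono ?_ ((Set.Ici_infinite n₁).image
    (Nat.cast_injective (R := ℚ)).injOn)
  rintro _ ⟨n, hn, rfl⟩
  obtain ⟨h1, h2⟩ := hn₁ n hn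
  change Polynomial.eval (n : ℚ) _ = _
  rw [← h2, h1, Polynomial.eval_C, Int.cast_natCast]

theorem multiplicity_eq {N : ℕ} {J : Ideal (LocalRing N)} {μ n₀ : ℕ}
    (h : ∀ n, n₀ ≤ n → hilbertFunction J n = μ) : multiplicity J = μ := by
  rw [multiplicity, hilbertPolynomial_eq_C h, Polynomial.leadingCoeff_C, Polynomial.natDegree_C]
  simp

theorem hilbertFunction_eq_of_regularityIndex_le {N : ℕ} {J : Ideal (LocalRing N)} {μ n₀ : ℕ}
    (h : ∀ n, n₀ ≤ n → hilbertFunction J n = μ) {n : ℕ} (hn : regularityIndex J ≤ n) :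
    hilbertFunction J n = μ := by
  have hP := hilbertPolynomial_eq_C h
  have hmem : regularityIndex J ∈ {m : ℕ | ∀ k : ℕ, m ≤ k →
      (hilbertFunction J k : ℚ) = (hilbertPolynomial J).eval (k : ℚ)} := by
    refine Nat.sInf_mem ⟨n₀, fun k hk => ?_⟩
    rw [hP, h k hk, Polynomial.eval_C, Int.cast_natCast]
  have h1 := hmem n hn
  rw [hP, Polynomial.eval_C] at h1
  exact_mod_cast h1

theorem stdMonomials_localClosure {N : ℕ} (I : Ideal (PolyRing N)) (j : ℕ) :
    stdMonomials (localClosure I) j = stdMonomials I j := by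
  ext α
  rw [mem_stdMonomials_iff, mem_stdMonomials_iff, localClosure_sup_pow]

/-! ### Embedded components and eliminating dual spaces -/

theorem pow_le_localClosure_sup_span_pow {N c : ℕ} {I : Ideal (PolyRing N)} {x : PolyRing N}
    (hc : originIdeal N ^ c ≤ localClosure (I ⊔ Ideal.span {x})) (e : ℕ) :
    originIdeal N ^ (c * (1 + e)) ≤ localClosure (I ⊔ Ideal.span {x ^ e}) := by
  rw [localClosure, ← Ideal.map_le_iff_le_comap] at hc ⊢
  rw [pow_mul, Ideal.map_pow]
  refine (Ideal.pow_right_mono hc _).trans ?_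
  rw [extend, ← Ideal.map_pow]
  refine Ideal.map_mono (Ideal.sup_pow_add_le_pow_sup_pow.trans ?_)
  rw [pow_one, Ideal.span_singleton_pow]

theorem mem_act_iff {N : ℕ} {g : PolyRing N} {L : Submodule ℂ (Module.Dual ℂ (PolyRing N))}
    {q : Module.Dual ℂ (PolyRing N)} :
    q ∈ act g L ↔ ∃ p ∈ L, ∀ f, p (g * f) = q f := by
  rw [act, Submodule.mem_map]
  refine exists_congr fun p => and_congr_right fun _ => ?_
  rw [LinearMap.ext_iff]
  rfl

theorem act_eliminatingDual_le {N : ℕ} (I : Ideal (PolyRing N)) (i : Fin N) (k : ℕ) :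
    act (X i) (eliminatingDual I {i} k) ≤ eliminatingDual I {i} ((k : ℤ) - 1) := by
  intro q hq
  obtain ⟨p, hp, hpq⟩ := mem_act_iff.1 hq
  rw [show (k : ℤ) = ((k + 1 : ℕ) : ℤ) - 1 by push_cast; ring,
    mem_eliminatingDual_singleton_iff] at hp
  rw [mem_eliminatingDual_singleton_iff]
  obtain ⟨m, hm⟩ := hp
  refine ⟨m, fun f hf => ?_⟩
  rw [← hpq]
  refine hm _ ?_
  obtain ⟨u, hu, w, hw, rfl⟩ := Submodule.mem_sup.1 hf
  obtain ⟨u, hu', v, hv, rfl⟩ := Submodule.mem_sup.1 hu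
  obtain ⟨g, rfl⟩ := Ideal.mem_span_singleton'.1 hv
  rw [mul_add, mul_add]
  refine add_mem (Ideal.mem_sup_left (add_mem (Ideal.mem_sup_left (Ideal.mul_mem_left _ _ hu'))
    (Ideal.mem_sup_right ?_))) (Ideal.mem_sup_right (Ideal.mul_mem_left _ _ hw))
  exact Ideal.mem_span_singleton'.2 ⟨g, by ring⟩

/-- Division of q by x means extending xf ↦ q(f) to a functional killing W. This is possible once q
kills W : x, which regularity of x modulo J ensures by cancelling x from a relation s x f = u + g
x^{k+1}. -/
theorem eliminatingDual_le_act {N c : ℕ} {I : Ideal (PolyRing N)} {i : Fin N}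
    (hc : originIdeal N ^ c ≤ localClosure (I ⊔ Ideal.span {X i}))
    (hreg : ∀ f, X i * f ∈ localClosure I → f ∈ localClosure I) (k : ℕ) :
    eliminatingDual I {i} ((k : ℤ) - 1) ≤ act (X i) (eliminatingDual I {i} k) := by
  intro q hq
  obtain ⟨m, hm⟩ := (mem_eliminatingDual_singleton_iff _ _ _ _).1 hq
  -- The power of 𝔪 makes functionals on R/W differential; its exponent is large enough for that
  -- power to lie in the local closure of the other two summands.
  set W := I ⊔ Ideal.span {(X i : PolyRing N) ^ (k + 1)} ⊔ originIdeal N ^ (c * (1 + (k + 1)))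
    with hW
  have hWle : W ≤ localClosure (I ⊔ Ideal.span {(X i : PolyRing N) ^ (k + 1)}) :=
    sup_le (le_localClosure _) (pow_le_localClosure_sup_span_pow hc _)
  have sup_pow_le : I ⊔ originIdeal N ^ m ≤
      I ⊔ Ideal.span {(X i : PolyRing N) ^ k} ⊔ originIdeal N ^ m := sup_le_sup_right le_sup_left _
  have hcolon : ∀ f, X i * f ∈ W → q f = 0 := by
    intro f hf
    obtain ⟨s, hs, hsf⟩ := mem_localClosure_iff.1 (hWle hf)
    obtain ⟨u, hu, v, hv, huv⟩ := Submodule.mem_sup.1 hsf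
    obtain ⟨g, rfl⟩ := Ideal.mem_span_singleton'.1 hv
    have h1 : s * f - g * X i ^ k ∈ localClosure I := by
      refine hreg _ (le_localClosure I ?_)
      have : X i * (s * f - g * X i ^ k) = u := by
        rw [eq_sub_of_add_eq huv]
        ring
      rwa [this]
    obtain ⟨t, ht⟩ := exists_mul_sub_one_mem hs m
    have h2 : f = t * (s * f - g * X i ^ k) + t * g * X i ^ k - f * (t * s - 1) := by ring
    refine hm f ?_
    rw [h2]
    refine sub_mem (add_mem (Ideal.mul_mem_left _ _ ?_) ?_) ?_
    · exact sup_pow_le (localClosure_le_sup_pow I m h1)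
    · exact Ideal.mem_sup_left (Ideal.mem_sup_right (Ideal.mem_span_singleton'.2 ⟨_, rfl⟩))
    · exact Ideal.mem_sup_right (Ideal.mul_mem_left _ _ ht)
  let φ : PolyRing N →ₗ[ℂ] PolyRing N ⧸ W :=
    (Ideal.Quotient.mkₐ ℂ W).toLinearMap ∘ₗ LinearMap.mulLeft ℂ (X i : PolyRing N)
  have hq' : q ∈ LinearMap.range φ.dualMap := by
    rw [LinearMap.range_dualMap_eq_dualAnnihilator_ker, Submodule.mem_dualAnnihilator]
    exact fun f hf => hcolon f (Ideal.Quotient.eq_zero_iff_mem.1 hf)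
  obtain ⟨p, rfl⟩ := hq'
  refine mem_act_iff.2 ⟨p ∘ₗ (Ideal.Quotient.mkₐ ℂ W).toLinearMap, ?_, fun f => rfl⟩
  rw [show (k : ℤ) = ((k + 1 : ℕ) : ℤ) - 1 by push_cast; ring, mem_eliminatingDual_singleton_iff]
  refine ⟨c * (1 + (k + 1)), fun f hf => ?_⟩
  have h0 : Ideal.Quotient.mkₐ ℂ W f = 0 := Ideal.Quotient.eq_zero_iff_mem.2 hf
  rw [LinearMap.comp_apply, AlgHom.toLinearMap_apply, h0, map_zero]

/-- A functional separating z from I + 𝔪^k has x-order below k because x^k ∈ 𝔪^k. If it were x·p,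
its value at z would be p(xz) = 0. -/
theorem not_eliminatingDual_le_act {N k : ℕ} {I : Ideal (PolyRing N)} {i : Fin N} {z : PolyRing N}
    (hz : z ∉ I ⊔ originIdeal N ^ k) (hxz : X i * z ∈ localClosure I) :
    ¬ eliminatingDual I {i} ((k : ℤ) - 1) ≤ act (X i) (eliminatingDual I {i} k) := by
  intro hle
  obtain ⟨q, hqz, hq⟩ := Submodule.exists_le_ker_of_notMem
    (p := (I ⊔ originIdeal N ^ k).restrictScalars ℂ) hz
  have hqker : ∀ f ∈ I ⊔ originIdeal N ^ k, q f = 0 := fun f hf => hq hf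
  have hmem : q ∈ eliminatingDual I {i} ((k : ℤ) - 1) := by
    have hle' : I ⊔ Ideal.span {(X i : PolyRing N) ^ k} ⊔ originIdeal N ^ k ≤
        I ⊔ originIdeal N ^ k := by
      refine sup_le (sup_le le_sup_left ?_) le_sup_right
      rw [Ideal.span_singleton_le_iff_mem]
      have hX : (X i : PolyRing N) ∈ originIdeal N := Ideal.subset_span ⟨i, rfl⟩
      exact Ideal.mem_sup_right (Ideal.pow_mem_pow hX k)
    exact (mem_eliminatingDual_singleton_iff _ _ _ _).2 ⟨k, fun f hf => hqker f (hle' hf)⟩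
  obtain ⟨p, hp, hpq⟩ := mem_act_iff.1 (hle hmem)
  rw [show (k : ℤ) = ((k + 1 : ℕ) : ℤ) - 1 by push_cast; ring,
    mem_eliminatingDual_singleton_iff] at hp
  obtain ⟨m, hm⟩ := hp
  have hle' : I ⊔ originIdeal N ^ m ≤
      I ⊔ Ideal.span {(X i : PolyRing N) ^ (k + 1)} ⊔ originIdeal N ^ m :=
    sup_le_sup_right le_sup_left _
  apply hqz
  rw [← hpq]
  exact hm _ (hle' (localClosure_le_sup_pow I m hxz))

end DualSpace

end

theorem mainTheorem4 (n : ℕ) (I : Ideal (DualSpace.PolyRing (n + 1)))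
    (hdim : DualSpace.IsCurveAtOrigin I)
    (hpos : DualSpace.InGeneralPosition I 0)
    (k : ℤ)
    (hk : k = max (DualSpace.regularityIndex (DualSpace.extend I) : ℤ)
      ((DualSpace.multiplicity (DualSpace.extend I) : ℤ) - 1)) :
    DualSpace.OriginIsEmbedded I ↔
      DualSpace.act (MvPolynomial.X 0) (DualSpace.eliminatingDual I {0} k) <
        DualSpace.eliminatingDual I {0} (k - 1) := by
  open DualSpace in
  have hX : (MvPolynomial.X 0 : PolyRing (n + 1)) ∈ originIdeal (n + 1) :=
    Ideal.subset_span ⟨0, rfl⟩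
  obtain ⟨c, hc⟩ := exists_pow_le_localClosure_sup_span hdim hpos
  have hc' : ∀ m, originIdeal (n + 1) ^ c ≤
      localClosure I ⊔ Ideal.span {MvPolynomial.X 0} ⊔ originIdeal (n + 1) ^ m := fun m =>
    (hc.trans (localClosure_le_sup_pow _ m)).trans
      (sup_le_sup_right (sup_le_sup_right (le_localClosure I) _) _)
  obtain ⟨μ, n₀, hμ⟩ := exists_card_stdMonomials_eq hX hc'
  have hH : ∀ m, n₀ ≤ m → hilbertFunction (extend I) m = μ := fun m hm => by
    rw [hilbertFunction_extend, ← stdMonomials_localClosure, hμ m hm]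
  rw [multiplicity_eq hH] at hk
  -- The maximum is taken in ℤ so that μ - 1 is not truncated; it is nonnegative because the
  -- regularity index is.
  lift k to ℕ using hk ▸ le_max_of_le_left (Int.natCast_nonneg _)
  have hμk : ∀ m, k ≤ m → (stdMonomials (localClosure I) m).card = μ := fun m hm => by
    have h := hilbertFunction_eq_of_regularityIndex_le hH (n := m) (by omega)
    rw [hilbertFunction_extend] at h
    rw [stdMonomials_localClosure]
    exact_mod_cast h
  have hkμ : μ ≤ k + 1 := by omega
  rw [originIsEmbedded_iff hdim hpos, lt_iff_le_not_ge,
    and_iff_right (act_eliminatingDual_le I 0 k)]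
  constructor
  · rintro ⟨z, hz, hxz⟩
    refine not_eliminatingDual_le_act (fun hmem => hz ?_) hxz
    rw [← localClosure_sup_pow] at hmem
    rw [← localClosure_localClosure]
    refine mem_localClosure_of_forall_mem_sup_pow fun m => ?_
    -- The Hilbert functions are compared only from degree k on, hence the exponent max k m.
    have h := colonElement_inf_sup_pow_le hX hc' hμk hkμ (le_max_left k m) ⟨hxz, hmem⟩
    have hle : localClosure I ⊔ originIdeal (n + 1) ^ max k m ≤
        localClosure I ⊔ originIdeal (n + 1) ^ m :=
      sup_le_sup_left (Ideal.pow_le_pow_right (le_max_right k m)) _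
    exact hle h
  · intro h
    by_contra! hreg
    exact h (eliminatingDual_le_act hc (fun f hf => by_contra fun hf' => hreg f hf' hf) k)
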